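/- Let $\tau$ be a vocabulary consisting of finitely many constant symbols and relation symbols; the identity relation $=$ is available in every vocabulary and counts as a relation symbol of $\tau$. All structures are finite and nonempty. Second-order formulas over $\tau$ may quantify over elements and over relations of any arity, in any nesting order, with the usual (full) semantics. They may have free first-order variables but no free relation variables. Two such formulas are equivalent if they have the same truth value in every finite $\tau$-structure under every interpretation of the free first-order variables. For sets $\mathcal L_1,\mathcal L_2$ of formulas, $\mathcal L_1\le\mathcal L_2$ means that every formula of $\mathcal L_1$ is equivalent to a formula of $\mathcal L_2$. For $k\ge 1$, $\Sigma^1_k$ (resp. $\Pi^1_k$) is the set of formulas $Q_1R_1\cdots Q_mR_m\,\varphi$ with $Q_i\in\{\exists,\forall\}$, relation variables $R_i$, and $\varphi$ free of second-order quantifiers, such that $Q_1=\exists$ (resp. $Q_1=\forall$) and the sequence $Q_1,\dots,Q_m$ alternates exactly $k-1$ times between $\exists$ and $\forall$. $\mathrm{SO\text{-}KROM}^r$ is the set of formulas $$Q_1R_1\cdots Q_mR_m\,\forall\bar x\,(C_1\wedge\cdots\wedge C_n),$$ where $Q_i\in\{\exists,\forall\}$, the $R_i$ are relation variables, and each $C_j$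 is a disjunction $\beta_1\vee\cdots\vee\beta_q\vee H_1\vee H_2$ ($q\ge 0$) such that each $\beta_s$ is $P\bar y$ or $\neg P\bar y$ with $P\in\tau$ (possibly $=$), and each $H_t$ is $R_i\bar z$, $\neg R_i\bar z$, $\exists z_1\cdots\exists z_a\,R_iz_1\dots z_a$ with $a$ the arity of $R_i$, or $\bot$; here $\bar y,\bar z$ are tuples of first-order variables and constants. $\Sigma^1_k\text{-}\mathrm{KROM}^r$ (resp. $\Pi^1_k\text{-}\mathrm{KROM}^r$) is the set of those $\mathrm{SO\text{-}KROM}^r$ formulas whose second-order prefix starts with $\exists$ (resp. $\forall$) and alternates exactly $k-1$ times. **Proposition.** Every second-order formula is equivalent to an $\mathrm{SO\text{-}KROM}^r$ formula. More precisely, for each $k\ge1$: if $k$ is even, then $\Sigma^1_k\le\Sigma^1_{k+1}\text{-}\mathrm{KROM}^r$; and if $k$ is odd, then $\Pi^1_k\le\Pi^1_{k+1}\text{-}\mathrm{KROM}^r$. -/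

import Mathlib

universe u v w x

namespace SecondOrder

/-- `RelVar Γ a` is the type of second-order (relation) variables of arity `a` in the context `Γ`;
the context `Γ` lists the arities of the relation variables in scope, the most recently
quantified one first. -/
inductive RelVar : List ℕ → ℕ → Type
  | zero {Γ : List ℕ} {a : ℕ} : RelVar (a :: Γ) a
  | succ {Γ : List ℕ} {a b : ℕ} : RelVar Γ a → RelVar (b :: Γ) a

/-- An interpretation of the relation variables of the context `Γ` by relations on `A`. -/
abbrev RelEnv (A : Type x) (Γ : List ℕ) : Type x :=
  ∀ a : ℕ, RelVar Γ a → (Fin a → A) → Prop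

/-- The interpretation of the empty context. -/
def RelEnv.nil (A : Type x) : RelEnv A [] := fun _ X => nomatch X

/-- Extend an interpretation by a value `R` for the newest relation variable. -/
def RelEnv.cons {A : Type x} {Γ : List ℕ} {b : ℕ} (R : (Fin b → A) → Prop) (S : RelEnv A Γ) :
    RelEnv A (b :: Γ)
  | _, .zero => R
  | _, .succ X => S _ X

/-- Second-order formulas over the vocabulary `L`. Free first-order variables are
indexed by `α`; `n` bound first-order variables, indexed by `Fin n`, and the relation variables
of the context `Γ` are in scope. A quantified first-order variable gets the index `n`, as in
`FirstOrder.Language.BoundedFormula`. -/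
inductive SOFormula (L : FirstOrder.Language.{u, v}) (α : Type w) : List ℕ → ℕ → Type (max u v w)
  | falsum {Γ n} : SOFormula L α Γ n
  | equal {Γ n} (t₁ t₂ : L.Term (α ⊕ Fin n)) : SOFormula L α Γ n
  | rel {Γ n} {a : ℕ} (P : L.Relations a) (ts : Fin a → L.Term (α ⊕ Fin n)) : SOFormula L α Γ n
  | relVar {Γ n} {a : ℕ} (X : RelVar Γ a) (ts : Fin a → L.Term (α ⊕ Fin n)) : SOFormula L α Γ n
  | not {Γ n} (φ : SOFormula L α Γ n) : SOFormula L α Γ n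
  | and {Γ n} (φ ψ : SOFormula L α Γ n) : SOFormula L α Γ n
  | or {Γ n} (φ ψ : SOFormula L α Γ n) : SOFormula L α Γ n
  | all {Γ n} (φ : SOFormula L α Γ (n + 1)) : SOFormula L α Γ n
  | ex {Γ n} (φ : SOFormula L α Γ (n + 1)) : SOFormula L α Γ n
  | allRel {Γ n} (a : ℕ) (φ : SOFormula L α (a :: Γ) n) : SOFormula L α Γ n
  | exRel {Γ n} (a : ℕ) (φ : SOFormula L α (a :: Γ) n) : SOFormula L α Γ n

namespace SOFormula

variable {L : FirstOrder.Language.{u, v}} {α : Type w}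

/-- Tarskian truth with the standard (full) semantics of the second-order quantifiers. -/
def RealizeIn {A : Type x} [L.Structure A] :
    {Γ : List ℕ} → {n : ℕ} → SOFormula L α Γ n → (α → A) → (Fin n → A) → RelEnv A Γ → Prop
  | _, _, falsum, _, _, _ => False
  | _, _, equal t₁ t₂, f, s, _ => t₁.realize (Sum.elim f s) = t₂.realize (Sum.elim f s)
  | _, _, rel P ts, f, s, _ => FirstOrder.Language.Structure.RelMap P fun i => (ts i).realize (Sum.elim f s)
  | _, _, relVar X ts, f, s, S => S _ X fun i => (ts i).realize (Sum.elim f s)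
  | _, _, not φ, f, s, S => ¬ φ.RealizeIn f s S
  | _, _, and φ ψ, f, s, S => φ.RealizeIn f s S ∧ ψ.RealizeIn f s S
  | _, _, or φ ψ, f, s, S => φ.RealizeIn f s S ∨ ψ.RealizeIn f s S
  | _, _, all φ, f, s, S => ∀ c : A, φ.RealizeIn f (Fin.snoc s c) S
  | _, _, ex φ, f, s, S => ∃ c : A, φ.RealizeIn f (Fin.snoc s c) S
  | _, _, allRel a φ, f, s, S => ∀ R : (Fin a → A) → Prop, φ.RealizeIn f s (RelEnv.cons R S)
  | _, _, exRel a φ, f, s, S => ∃ R : (Fin a → A) → Prop, φ.RealizeIn f s (RelEnv.cons R S)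

/-- `A ⊨ φ[f]` for a formula in which all relation variables are quantified and the free
first-order variables are interpreted by `f`. -/
def Realize {A : Type x} [L.Structure A] (φ : SOFormula L α [] 0) (f : α → A) : Prop :=
  φ.RealizeIn f Fin.elim0 (RelEnv.nil A)

/-- No second-order quantifier occurs in the formula (relation variables may occur). -/
def IsFirstOrder : {Γ : List ℕ} → {n : ℕ} → SOFormula L α Γ n → Prop
  | _, _, falsum => True
  | _, _, equal _ _ => True
  | _, _, rel _ _ => True
  | _, _, relVar _ _ => True
  | _, _, not φ => φ.IsFirstOrder
  | _, _, and φ ψ => φ.IsFirstOrder ∧ ψ.IsFirstOrder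
  | _, _, or φ ψ => φ.IsFirstOrder ∧ ψ.IsFirstOrder
  | _, _, all φ => φ.IsFirstOrder
  | _, _, ex φ => φ.IsFirstOrder
  | _, _, allRel _ _ => False
  | _, _, exRel _ _ => False

/-- `∃ z₁ ⋯ ∃ z_a φ`. -/
def exs {Γ : List ℕ} {n : ℕ} : (a : ℕ) → SOFormula L α Γ (n + a) → SOFormula L α Γ n
  | 0, φ => φ
  | a + 1, φ => exs a (ex φ)

/-- `∃ z₁ ⋯ ∃ z_a X z₁ … z_a`, where `a` is the arity of `X`. -/
def exsRelVar {Γ : List ℕ} {n a : ℕ} (X : RelVar Γ a) : SOFormula L α Γ n :=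
  exs a (relVar X fun i => FirstOrder.Language.Term.var (Sum.inr (Fin.natAdd n i)))

/-- The disjuncts `P ȳ` and `¬ P ȳ`, with `P` in the vocabulary or the identity relation. -/
inductive IsVocLiteral {Γ : List ℕ} {n : ℕ} : SOFormula L α Γ n → Prop
  | equal (t₁ t₂ : L.Term (α ⊕ Fin n)) : IsVocLiteral (equal t₁ t₂)
  | notEqual (t₁ t₂ : L.Term (α ⊕ Fin n)) : IsVocLiteral (not (equal t₁ t₂))
  | rel {a : ℕ} (P : L.Relations a) (ts : Fin a → L.Term (α ⊕ Fin n)) : IsVocLiteral (rel P ts)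
  | notRel {a : ℕ} (P : L.Relations a) (ts : Fin a → L.Term (α ⊕ Fin n)) :
      IsVocLiteral (not (rel P ts))

/-- The second-order disjuncts `X z̄`, `¬ X z̄`, `∃ z̄ X z̄` and `⊥` of a revised Krom clause. -/
inductive IsKromRDisjunct {Γ : List ℕ} {n : ℕ} : SOFormula L α Γ n → Prop
  | relVar {a : ℕ} (X : RelVar Γ a) (ts : Fin a → L.Term (α ⊕ Fin n)) :
      IsKromRDisjunct (relVar X ts)
  | notRelVar {a : ℕ} (X : RelVar Γ a) (ts : Fin a → L.Term (α ⊕ Fin n)) :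
      IsKromRDisjunct (not (relVar X ts))
  | exsRelVar {a : ℕ} (X : RelVar Γ a) : IsKromRDisjunct (exsRelVar X)
  | falsum : IsKromRDisjunct falsum

/-- Revised Krom clauses `β₁ ∨ (⋯ ∨ (β_q ∨ (H₁ ∨ H₂)))`, `q ≥ 0`. -/
inductive IsKromRClause {Γ : List ℕ} {n : ℕ} : SOFormula L α Γ n → Prop
  | base {H₁ H₂ : SOFormula L α Γ n} (h₁ : IsKromRDisjunct H₁) (h₂ : IsKromRDisjunct H₂) :
      IsKromRClause (or H₁ H₂)
  | or {β C : SOFormula L α Γ n} (hβ : IsVocLiteral β) (hC : IsKromRClause C) :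
      IsKromRClause (or β C)

/-- Conjunctions of one or more revised Krom clauses, with any bracketing. -/
inductive IsKromRConj {Γ : List ℕ} {n : ℕ} : SOFormula L α Γ n → Prop
  | clause {C : SOFormula L α Γ n} (h : IsKromRClause C) : IsKromRConj C
  | and {φ ψ : SOFormula L α Γ n} (hφ : IsKromRConj φ) (hψ : IsKromRConj ψ) :
      IsKromRConj (and φ ψ)

/-- Formulas `∀ x̄ (C₁ ∧ ⋯ ∧ C_r)` with revised Krom clauses `C_j`. -/
inductive IsKromRMatrix {Γ : List ℕ} : {n : ℕ} → SOFormula L α Γ n → Prop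
  | conj {n : ℕ} {φ : SOFormula L α Γ n} (h : IsKromRConj φ) : IsKromRMatrix φ
  | all {n : ℕ} {φ : SOFormula L α Γ (n + 1)} (h : IsKromRMatrix φ) : IsKromRMatrix (all φ)

end SOFormula

/-- The two kinds of second-order quantifiers. -/
inductive Quant
  | ex
  | all
  deriving DecidableEq

/-- The number of alternations between existential and universal quantifiers in a prefix. -/
def alternations : List Quant → ℕ
  | q :: q' :: qs => (if q = q' then 0 else 1) + alternations (q' :: qs)
  | _ => 0

section

variable {L : FirstOrder.Language.{u, v}} {α : Type w}

/-- `HasPrefix M qs φ`: `φ` is `Q₁R₁ ⋯ Q_mR_m θ` with second-order quantifiers of the kinds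
`qs = [Q₁, …, Q_m]` (and any arities), where the formula `θ` satisfies `M`. -/
inductive HasPrefix (M : ∀ Γ : List ℕ, SOFormula L α Γ 0 → Prop) :
    {Γ : List ℕ} → List Quant → SOFormula L α Γ 0 → Prop
  | matrix {Γ : List ℕ} {θ : SOFormula L α Γ 0} (h : M Γ θ) : HasPrefix M [] θ
  | exRel {Γ : List ℕ} {a : ℕ} {qs : List Quant} {φ : SOFormula L α (a :: Γ) 0}
      (h : HasPrefix M qs φ) : HasPrefix M (Quant.ex :: qs) (SOFormula.exRel a φ)
  | allRel {Γ : List ℕ} {a : ℕ} {qs : List Quant} {φ : SOFormula L α (a :: Γ) 0}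
      (h : HasPrefix M qs φ) : HasPrefix M (Quant.all :: qs) (SOFormula.allRel a φ)

/-- Formulas whose second-order prefix starts with the quantifier `q`, alternates `k - 1` times,
and is followed by a formula satisfying `M` (there are none for `k = 0`). -/
def PrefixClass (M : ∀ Γ : List ℕ, SOFormula L α Γ 0 → Prop) (q : Quant) (k : ℕ) :
    Set (SOFormula L α [] 0) :=
  {φ | ∃ qs : List Quant, HasPrefix M (q :: qs) φ ∧ alternations (q :: qs) + 1 = k}

end

variable (L : FirstOrder.Language.{u, v}) (α : Type w)

/-- The class `Σ¹_k`. -/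
def Sigma1 (k : ℕ) : Set (SOFormula L α [] 0) :=
  PrefixClass (fun _ θ => θ.IsFirstOrder) Quant.ex k

/-- The class `Π¹_k`. -/
def Pi1 (k : ℕ) : Set (SOFormula L α [] 0) :=
  PrefixClass (fun _ θ => θ.IsFirstOrder) Quant.all k

/-- Second-order revised Krom logic, `SO-KROM^r`. -/
def SOKromR : Set (SOFormula L α [] 0) :=
  {φ | ∃ qs : List Quant, HasPrefix (fun _ θ => θ.IsKromRMatrix) qs φ}

/-- The class `Σ¹_k-KROM^r`. -/
def Sigma1KromR (k : ℕ) : Set (SOFormula L α [] 0) :=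
  PrefixClass (fun _ θ => θ.IsKromRMatrix) Quant.ex k

/-- The class `Π¹_k-KROM^r`. -/
def Pi1KromR (k : ℕ) : Set (SOFormula L α [] 0) :=
  PrefixClass (fun _ θ => θ.IsKromRMatrix) Quant.all k

variable {L α}

/-- Two formulas are equivalent if they agree on all finite (nonempty) structures, under all
interpretations of their free first-order variables. -/
def FinEquiv (φ ψ : SOFormula L α [] 0) : Prop :=
  ∀ (A : Type x) [L.Structure A] [Finite A] [Nonempty A] (f : α → A), φ.Realize f ↔ ψ.Realize f

/-- `C ≤ D`: every formula of `C` is equivalent to a formula of `D` on finite structures. -/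
def LogicLE (C D : Set (SOFormula L α [] 0)) : Prop :=
  ∀ φ ∈ C, ∃ ψ ∈ D, FinEquiv.{u, v, w, x} φ ψ

end SecondOrder

/-!
The heart of the matter is that every first-order formula with relation variables can be written
as `∀ T̄ ∃ x̄ ∀ ȳ ψ`, where `ψ` is a conjunction of *unit clauses*: clauses with any number of
vocabulary literals, but at most one literal that contains a relation variable. From there, one
more existential quantifier over a relation `S` gives a revised Krom formula: the disjunct
`∃ z̄ S z̄` says that there is a witness, and the clauses `S x̄ → C` for the unit clauses `C` of `ψ` say
that every tuple in `S` is one; they contain at most two literals with relation variables.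

The reduction to unit clauses proceeds by induction on the formula, treating a formula and its
negation at the same time, and takes place in structures with at least two elements.
* Disjunctions of queries `∃ x̄ ∀ ȳ ψ` are of the same form, because two new existentially
  quantified variables `c`, `d` can select a disjunct by `c = d` or `c ≠ d`, which are vocabulary
  literals (`IsExAll.or`).
* Conjunctions become disjunctions through a universally quantified relation variable of arity
  `0`: `P ∧ Q` is `∀ p, (p ∧ P) ∨ (¬ p ∧ Q)` (`IsPrenex.and`).
* Likewise `∀ c, P c` is `∀ X, (∀ y, ¬ X y) ∨ ∃ c, X c ∧ P c` (`IsPrenex.forall_var_of_isExAll`).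
* Quantifiers over relations are moved to the front; when they pass a quantifier over elements of
  the other kind, the arity of the relation grows by one (`IsPrenex.exists_var`,
  `IsPrenex.forall_var`).

The same induction handles second-order quantifiers anywhere in the formula, which gives the
statement on all second-order formulas. If the formula is first-order, then only universal
quantifiers over relations are introduced. Hence a prefix that ends with a universal quantifier,
as is the case for the stated parities of `k`, gets just one more alternation, from the relation
`S`.

In a one-element structure, the truth of a second-order formula depends only on the set of
relation symbols that hold (`SOFormula.realizeIn_iff_of_subsingleton`), and there are finitely
many such sets. Each set for which the formula is false is excluded by a clause of vocabulary
literals. To confine these clauses to one-element structures, `S` gets two more arguments, which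
are required to be distinct, and the disjunct `∃ z̄ S z̄` is added to the clauses
(`IsExAll.exists_kromDefines`).
-/

namespace SecondOrder

open FirstOrder

/-! ### Substitution of relation variables -/

/-- A substitution of relation variables: `X t̄` is replaced by `Y s̄`, where each entry of `s̄` is
an entry of `t̄` or one of the first-order variables in `V`. -/
abbrev RelSubst (Γ Δ : List ℕ) (V : Type w) : Type w :=
  ∀ a : ℕ, RelVar Γ a → Σ b : ℕ, RelVar Δ b × (Fin b → Fin a ⊕ V)

namespace RelSubst

variable {Γ Δ : List ℕ} {V : Type w}

/-- The interpretation of the substituted variables induced by one of the substituting ones. -/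
def env {A : Type x} (σ : RelSubst Γ Δ V) (v : V → A) (S : RelEnv A Δ) : RelEnv A Γ :=
  fun a X t => S _ (σ a X).2.1 fun j => Sum.elim t v ((σ a X).2.2 j)

/-- Extend a substitution by a rule for one more relation variable, given by the positions `pos`. -/
def cons (σ : RelSubst Γ Δ V) {a b : ℕ} (pos : Fin b → Fin a ⊕ V) : RelSubst (a :: Γ) (b :: Δ) V
  | _, .zero => ⟨b, .zero, pos⟩
  | _, .succ X => ⟨(σ _ X).1, .succ (σ _ X).2.1, (σ _ X).2.2⟩

theorem env_cons {A : Type x} (σ : RelSubst Γ Δ V) {a b : ℕ} (pos : Fin b → Fin a ⊕ V) (v : V → A)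
    (R : (Fin b → A) → Prop) (S : RelEnv A Δ) :
    env (cons σ pos) v (RelEnv.cons R S) =
      RelEnv.cons (fun t => R fun j => Sum.elim t v (pos j)) (env σ v S) := by
  funext a X
  cases X <;> rfl

/-- The identity substitution. -/
def id (Γ : List ℕ) (V : Type w) : RelSubst Γ Γ V := fun a X => ⟨a, X, Sum.inl⟩

/-- The substitution that only brings one more relation variable into scope. -/
def weaken (Γ : List ℕ) (b : ℕ) (V : Type w) : RelSubst Γ (b :: Γ) V :=
  fun a X => ⟨a, X.succ, Sum.inl⟩

theorem env_weaken {A : Type x} {b : ℕ} (v : V → A) (R : (Fin b → A) → Prop) (S : RelEnv A Γ) :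
    env (weaken Γ b V) v (RelEnv.cons R S) = S :=
  rfl

/-- Rename the first-order variables that occur in a substitution. -/
def map {W : Type w} (r : V → W) (σ : RelSubst Γ Δ V) : RelSubst Γ Δ W :=
  fun a X => ⟨(σ a X).1, (σ a X).2.1, fun j => Sum.map _root_.id r ((σ a X).2.2 j)⟩

theorem env_map {A : Type x} {W : Type w} (r : V → W) (σ : RelSubst Γ Δ V) (v : W → A)
    (S : RelEnv A Δ) : env (map r σ) v S = env σ (v ∘ r) S := by
  funext a X t
  simp only [env, map]
  congr 1
  funext j
  cases (σ a X).2.2 j <;> rfl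

end RelSubst

/-! ### Conjunctions of unit clauses -/

/-- A property of structures with at least two elements, an assignment of the first-order variables
in `V`, and an interpretation of the relation variables in `Γ`. -/
abbrev Query (L : FirstOrder.Language.{u, v}) (Γ : List ℕ) (V : Type w) :=
  ∀ (A : Type x) [L.Structure A] [Nontrivial A], (V → A) → RelEnv A Γ → Prop

section Classes

variable {L : FirstOrder.Language.{u, v}}

/-- Queries defined by a unit clause: a disjunction of literals in the vocabulary and of at most one
literal with a relation variable. -/
inductive IsUnitClause {Γ : List ℕ} {V : Type w} : Query.{u, v, w, x} L Γ V → Prop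
  | falsum : IsUnitClause fun _ _ _ _ _ => False
  | relVar {a : ℕ} (X : RelVar Γ a) (ts : Fin a → L.Term V) :
      IsUnitClause fun _ _ _ v S => S a X fun i => (ts i).realize v
  | notRelVar {a : ℕ} (X : RelVar Γ a) (ts : Fin a → L.Term V) :
      IsUnitClause fun _ _ _ v S => ¬ S a X fun i => (ts i).realize v
  | equal (t₁ t₂ : L.Term V) {P : Query L Γ V} (h : IsUnitClause P) :
      IsUnitClause fun A _ _ v S => t₁.realize v = t₂.realize v ∨ P A v S
  | notEqual (t₁ t₂ : L.Term V) {P : Query L Γ V} (h : IsUnitClause P) :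
      IsUnitClause fun A _ _ v S => ¬ t₁.realize v = t₂.realize v ∨ P A v S
  | rel {a : ℕ} (p : L.Relations a) (ts : Fin a → L.Term V) {P : Query L Γ V}
      (h : IsUnitClause P) :
      IsUnitClause fun A _ _ v S =>
        Language.Structure.RelMap p (fun i => (ts i).realize v) ∨ P A v S
  | notRel {a : ℕ} (p : L.Relations a) (ts : Fin a → L.Term V) {P : Query L Γ V}
      (h : IsUnitClause P) :
      IsUnitClause fun A _ _ v S =>
        ¬ Language.Structure.RelMap p (fun i => (ts i).realize v) ∨ P A v S

/-- Queries defined by a conjunction of one or more unit clauses. -/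
inductive IsUnitConj {Γ : List ℕ} {V : Type w} : Query.{u, v, w, x} L Γ V → Prop
  | clause {P : Query L Γ V} (h : IsUnitClause P) : IsUnitConj P
  | and {P Q : Query L Γ V} (hP : IsUnitConj P) (hQ : IsUnitConj Q) :
      IsUnitConj fun A _ _ v S => P A v S ∧ Q A v S

variable {Γ Δ : List ℕ} {V W : Type w}

theorem IsUnitClause.congr {P Q : Query.{u, v, w, x} L Γ V} (h : IsUnitClause P)
    (e : ∀ (A : Type x) [L.Structure A] [Nontrivial A] (v : V → A) (S : RelEnv A Γ),
      P A v S ↔ Q A v S) : IsUnitClause Q := by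
  have : P = Q := by
    funext A _ _ v S
    exact propext (e A v S)
  exact this ▸ h

theorem IsUnitConj.congr {P Q : Query.{u, v, w, x} L Γ V} (h : IsUnitConj P)
    (e : ∀ (A : Type x) [L.Structure A] [Nontrivial A] (v : V → A) (S : RelEnv A Γ),
      P A v S ↔ Q A v S) : IsUnitConj Q := by
  have : P = Q := by
    funext A _ _ v S
    exact propext (e A v S)
  exact this ▸ h

theorem IsUnitClause.subst {P : Query.{u, v, w, x} L Γ V} (h : IsUnitClause P) (r : V → W)
    (σ : RelSubst Γ Δ W) :
    IsUnitClause (L := L) (Γ := Δ) fun A _ _ w S => P A (w ∘ r) (RelSubst.env σ w S) := by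
  have key (A : Type x) [L.Structure A] (w : W → A) {a : ℕ} (X : RelVar Γ a)
      (ts : Fin a → L.Term V) :
      (fun j => (Sum.elim (fun i => (ts i).relabel r) Language.Term.var
        ((σ a X).2.2 j) : L.Term W).realize w) =
      fun j => Sum.elim (fun i => (ts i).realize (w ∘ r)) w ((σ a X).2.2 j) := by
    funext j
    cases (σ a X).2.2 j <;> simp
  induction h with
  | falsum => exact .falsum
  | relVar X ts =>
    refine (IsUnitClause.relVar (σ _ X).2.1 fun j =>
      Sum.elim (fun i => (ts i).relabel r) Language.Term.var ((σ _ X).2.2 j)).congr ?_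
    intro A _ _ w S
    rw [key]
    rfl
  | notRelVar X ts =>
    refine (IsUnitClause.notRelVar (σ _ X).2.1 fun j =>
      Sum.elim (fun i => (ts i).relabel r) Language.Term.var ((σ _ X).2.2 j)).congr ?_
    intro A _ _ w S
    rw [key]
    rfl
  | equal t₁ t₂ _ ih =>
    refine (IsUnitClause.equal (t₁.relabel r) (t₂.relabel r) ih).congr ?_
    intros
    simp
  | notEqual t₁ t₂ _ ih =>
    refine (IsUnitClause.notEqual (t₁.relabel r) (t₂.relabel r) ih).congr ?_
    intros
    simp
  | rel p ts _ ih =>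
    refine (IsUnitClause.rel p (fun i => (ts i).relabel r) ih).congr ?_
    intros
    simp
  | notRel p ts _ ih =>
    refine (IsUnitClause.notRel p (fun i => (ts i).relabel r) ih).congr ?_
    intros
    simp

theorem IsUnitConj.subst {P : Query.{u, v, w, x} L Γ V} (h : IsUnitConj P) (r : V → W)
    (σ : RelSubst Γ Δ W) :
    IsUnitConj (L := L) (Γ := Δ) fun A _ _ w S => P A (w ∘ r) (RelSubst.env σ w S) := by
  induction h with
  | clause h => exact .clause (h.subst r σ)
  | and _ _ ih₁ ih₂ => exact .and ih₁ ih₂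

theorem IsUnitConj.rename {P : Query.{u, v, w, x} L Γ V} (h : IsUnitConj P) (r : V → W) :
    IsUnitConj (L := L) (Γ := Γ) fun A _ _ w S => P A (w ∘ r) S :=
  h.subst r (RelSubst.id Γ W)

theorem IsUnitConj.equal_or {P : Query.{u, v, w, x} L Γ V} (h : IsUnitConj P) (a b : V) :
    IsUnitConj (L := L) (Γ := Γ) fun A _ _ v S => v a = v b ∨ P A v S := by
  induction h with
  | clause h => exact .clause (h.equal (.var a) (.var b))
  | and _ _ ih₁ ih₂ =>
    refine (ih₁.and ih₂).congr ?_
    intros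
    tauto

theorem IsUnitConj.notEqual_or {P : Query.{u, v, w, x} L Γ V} (h : IsUnitConj P) (a b : V) :
    IsUnitConj (L := L) (Γ := Γ) fun A _ _ v S => ¬ v a = v b ∨ P A v S := by
  induction h with
  | clause h => exact .clause (h.notEqual (.var a) (.var b))
  | and _ _ ih₁ ih₂ =>
    refine (ih₁.and ih₂).congr ?_
    intros
    tauto

/-! ### Existential-universal queries over unit clauses -/

/-- Queries `∃ x̄ ∀ ȳ ψ` with a conjunction `ψ` of unit clauses. The quantified variables are
indexed by arbitrary finite types. -/
def IsExAll (P : Query.{u, v, w, x} L Γ V) : Prop :=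
  ∃ (X Y : Type) (_ : Finite X) (_ : Finite Y) (Q : Query.{u, v, w, x} L Γ (V ⊕ X ⊕ Y)),
    IsUnitConj Q ∧
    ∀ (A : Type x) [L.Structure A] [Nontrivial A] (v : V → A) (S : RelEnv A Γ),
      P A v S ↔ ∃ x : X → A, ∀ y : Y → A, Q A (Sum.elim v (Sum.elim x y)) S

namespace IsExAll

theorem of_isUnitConj {P : Query.{u, v, w, x} L Γ V} (h : IsUnitConj P) : IsExAll P :=
  ⟨Empty, Empty, inferInstance, inferInstance, _, h.rename Sum.inl, fun A _ _ v S => by simp⟩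

theorem subst {P : Query.{u, v, w, x} L Γ V} (h : IsExAll P) (r : V → W) (σ : RelSubst Γ Δ W) :
    IsExAll (L := L) (Γ := Δ) fun A _ _ w S => P A (w ∘ r) (RelSubst.env σ w S) := by
  obtain ⟨X, Y, hX, hY, Q, hQ, e⟩ := h
  refine ⟨X, Y, hX, hY, _, hQ.subst (Sum.map r _root_.id) (RelSubst.map Sum.inl σ), ?_⟩
  intro A _ _ w S
  simp only [e, RelSubst.env_map, Sum.elim_comp_inl, Sum.elim_comp_map, Function.comp_id]

/-- Existentially quantified variables are indices of `X`, so one more only enlarges `X`. -/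
theorem exists_var {P : Query.{u, v, w, x} L Γ (Option V)} (h : IsExAll P) :
    IsExAll (L := L) (Γ := Γ) fun A _ _ v S => ∃ c : A, P A (fun o => o.elim c v) S := by
  obtain ⟨X, Y, hX, hY, Q, hQ, e⟩ := h
  refine ⟨Option X, Y, inferInstance, hY, _, hQ.rename (Sum.elim
    (fun o => o.elim (Sum.inr (Sum.inl none)) Sum.inl)
    (Sum.elim (fun i => Sum.inr (Sum.inl (some i))) fun j => Sum.inr (Sum.inr j))), ?_⟩
  intro A _ _ v S
  have key (z : Option X → A) (y : Y → A) :
      (Sum.elim v (Sum.elim z y) : V ⊕ Option X ⊕ Y → A) ∘ (Sum.elim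
        (fun o : Option V => o.elim (Sum.inr (Sum.inl none)) Sum.inl)
        (Sum.elim (fun i => Sum.inr (Sum.inl (some i))) fun j => Sum.inr (Sum.inr j))) =
      Sum.elim (fun o => o.elim (z none) v) (Sum.elim (z ∘ some) y) := by
    funext k
    rcases k with (_ | _) | _ | _ <;> rfl
  simp only [e, key]
  constructor
  · rintro ⟨c, z, hz⟩
    exact ⟨fun o => o.elim c z, hz⟩
  · rintro ⟨z, hz⟩
    exact ⟨z none, z ∘ some, hz⟩

theorem and_isUnitConj {P R : Query.{u, v, w, x} L Γ V} (hR : IsUnitConj R) (h : IsExAll P) :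
    IsExAll (L := L) (Γ := Γ) fun A _ _ v S => R A v S ∧ P A v S := by
  obtain ⟨X, Y, hX, hY, Q, hQ, e⟩ := h
  refine ⟨X, Y, hX, hY, _, (hR.rename Sum.inl).and hQ, ?_⟩
  intro A _ _ v S
  have : Nonempty (Y → A) := inferInstance
  simp only [e, Sum.elim_comp_inl]
  constructor
  · rintro ⟨h, z, hz⟩
    exact ⟨z, fun y => ⟨h, hz y⟩⟩
  · rintro ⟨z, hz⟩
    exact ⟨(hz this.some).1, z, fun y => (hz y).2⟩

/-- A disjunction of two existential-universal queries is decided by two additional existentially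
quantified variables: the first disjunct is chosen if they are equal, the second one if not. The
case distinction consists of vocabulary literals and hence may be put into unit clauses. -/
theorem or {P P' : Query.{u, v, w, x} L Γ V} (h : IsExAll P) (h' : IsExAll P') :
    IsExAll (L := L) (Γ := Γ) fun A _ _ v S => P A v S ∨ P' A v S := by
  obtain ⟨X, Y, hX, hY, Q, hQ, e⟩ := h
  obtain ⟨X', Y', hX', hY', Q', hQ', e'⟩ := h'
  refine ⟨Bool ⊕ X ⊕ X', Y ⊕ Y', inferInstance, inferInstance, _,
    ((hQ.rename (Sum.map _root_.id (Sum.map (Sum.inr ∘ Sum.inl) Sum.inl))).notEqual_or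
      (Sum.inr (Sum.inl (Sum.inl false))) (Sum.inr (Sum.inl (Sum.inl true)))).and
    ((hQ'.rename (Sum.map _root_.id (Sum.map (Sum.inr ∘ Sum.inr) Sum.inr))).equal_or
      (Sum.inr (Sum.inl (Sum.inl false))) (Sum.inr (Sum.inl (Sum.inl true)))), ?_⟩
  intro A _ _ v S
  simp only [e, e', Sum.elim_comp_map, Function.comp_id, Sum.elim_inl, Sum.elim_inr]
  obtain ⟨a, b, hab⟩ := exists_pair_ne A
  constructor
  · rintro (⟨z, hz⟩ | ⟨z, hz⟩)
    · exact ⟨Sum.elim (fun _ => a) (Sum.elim z fun _ => a),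
        fun y => ⟨Or.inr (hz (y ∘ Sum.inl)), Or.inl rfl⟩⟩
    · exact ⟨Sum.elim (fun i => if i then a else b) (Sum.elim (fun _ => a) z),
        fun y => ⟨Or.inl (by simpa using hab.symm), Or.inr (hz (y ∘ Sum.inr))⟩⟩
  · rintro ⟨z, hz⟩
    by_cases hc : z (Sum.inl false) = z (Sum.inl true)
    · refine Or.inl ⟨z ∘ Sum.inr ∘ Sum.inl, fun y => ?_⟩
      exact ((hz (Sum.elim y fun _ => a)).1).resolve_left (fun h => h hc)
    · refine Or.inr ⟨z ∘ Sum.inr ∘ Sum.inr, fun y => ?_⟩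
      exact ((hz (Sum.elim (fun _ => a) y)).2).resolve_left hc

end IsExAll

/-! ### Second-order prefixes over existential-universal queries -/

/-- Queries obtained from existential-universal queries over unit clauses by quantification over
relations. Existential quantifiers over relations are allowed only if `full` holds. -/
inductive IsPrenex (full : Prop) {V : Type w} : {Γ : List ℕ} → Query.{u, v, w, x} L Γ V → Prop
  | base {Γ : List ℕ} {P : Query L Γ V} (h : IsExAll P) : IsPrenex full P
  | allRel {Γ : List ℕ} (a : ℕ) {P : Query L (a :: Γ) V} (h : IsPrenex full P) :
      IsPrenex full fun A _ _ v S => ∀ R : (Fin a → A) → Prop, P A v (RelEnv.cons R S)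
  | exRel {Γ : List ℕ} (hfull : full) (a : ℕ) {P : Query L (a :: Γ) V} (h : IsPrenex full P) :
      IsPrenex full fun A _ _ v S => ∃ R : (Fin a → A) → Prop, P A v (RelEnv.cons R S)

namespace IsPrenex

variable {full : Prop}

theorem congr {P Q : Query.{u, v, w, x} L Γ V} (h : IsPrenex full P)
    (e : ∀ (A : Type x) [L.Structure A] [Nontrivial A] (v : V → A) (S : RelEnv A Γ),
      P A v S ↔ Q A v S) : IsPrenex full Q := by
  have : P = Q := by
    funext A _ _ v S
    exact propext (e A v S)
  exact this ▸ h

theorem of_isUnitClause {P : Query.{u, v, w, x} L Γ V} (h : IsUnitClause P) : IsPrenex full P :=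
  .base (.of_isUnitConj (.clause h))

theorem subst {P : Query.{u, v, w, x} L Γ V} (h : IsPrenex full P) (r : V → W)
    (σ : RelSubst Γ Δ W) :
    IsPrenex full (L := L) (Γ := Δ) fun A _ _ w S => P A (w ∘ r) (RelSubst.env σ w S) := by
  induction h generalizing Δ with
  | base h => exact .base (h.subst r σ)
  | allRel a _ ih =>
    refine (allRel a (ih (RelSubst.cons σ Sum.inl))).congr ?_
    intros
    simp [RelSubst.env_cons]
  | exRel hfull a _ ih =>
    refine (exRel hfull a (ih (RelSubst.cons σ Sum.inl))).congr ?_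
    intros
    simp [RelSubst.env_cons]

theorem weaken {P : Query.{u, v, w, x} L Γ V} (h : IsPrenex full P) (b : ℕ) :
    IsPrenex full (L := L) (Γ := b :: Γ) fun A _ _ v S =>
      P A v (RelSubst.env (RelSubst.weaken Γ b V) v S) :=
  h.subst _root_.id (RelSubst.weaken Γ b V)

theorem or {P Q : Query.{u, v, w, x} L Γ V} (hP : IsPrenex full P) (hQ : IsPrenex full Q) :
    IsPrenex full (L := L) (Γ := Γ) fun A _ _ v S => P A v S ∨ Q A v S := by
  induction hP with
  | base hP =>
    induction hQ with
    | base hQ => exact .base (hP.or hQ)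
    | @allRel Γ a Q _ ih =>
      refine (allRel a (ih (hP.subst _root_.id (RelSubst.weaken Γ a V)))).congr ?_
      intro A _ _ v S
      simp only [RelSubst.env_weaken, Function.comp_id]
      exact forall_or_left
    | @exRel Γ hfull a Q _ ih =>
      refine (exRel hfull a (ih (hP.subst _root_.id (RelSubst.weaken Γ a V)))).congr ?_
      intro A _ _ v S
      simp only [RelSubst.env_weaken, Function.comp_id]
      exact exists_or.trans (or_congr_left (exists_const _))
  | allRel a _ ih =>
    refine (allRel a (ih (hQ.weaken a))).congr ?_
    intro A _ _ v S
    simp only [RelSubst.env_weaken]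
    exact forall_or_right
  | exRel hfull a _ ih =>
    refine (exRel hfull a (ih (hQ.weaken a))).congr ?_
    intro A _ _ v S
    simp only [RelSubst.env_weaken]
    exact exists_or.trans (or_congr_right (exists_const _))

/-- A conjunction `P ∧ Q` of existential-universal queries is expressed as
`∀ p, (p ∧ P) ∨ (¬ p ∧ Q)`, where `p` is a relation variable of arity `0`. -/
theorem and {P Q : Query.{u, v, w, x} L Γ V} (hP : IsPrenex full P) (hQ : IsPrenex full Q) :
    IsPrenex full (L := L) (Γ := Γ) fun A _ _ v S => P A v S ∧ Q A v S := by
  induction hP with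
  | @base Γ P hP =>
    induction hQ with
    | @base Γ Q hQ =>
      refine (allRel 0 (.base (((hP.subst _root_.id (RelSubst.weaken Γ 0 V)).and_isUnitConj
        (.clause (.relVar .zero Fin.elim0))).or
        ((hQ.subst _root_.id (RelSubst.weaken Γ 0 V)).and_isUnitConj
        (.clause (.notRelVar .zero Fin.elim0)))))).congr ?_
      intro A _ _ v S
      constructor
      · intro h
        refine ⟨((h fun _ => True).resolve_right fun h => h.1 trivial).2,
          ((h fun _ => False).resolve_left fun h => h.1).2⟩
      · rintro ⟨h₁, h₂⟩ R
        by_cases hR : R fun i => (Fin.elim0 i : L.Term V).realize v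
        · exact Or.inl ⟨hR, h₁⟩
        · exact Or.inr ⟨hR, h₂⟩
    | @allRel Γ a Q _ ih =>
      refine (allRel a (ih (hP.subst _root_.id (RelSubst.weaken Γ a V)))).congr ?_
      intro A _ _ v S
      simp only [RelSubst.env_weaken, Function.comp_id]
      exact forall_and.trans (and_congr_left fun _ => forall_const _)
    | @exRel Γ hfull a Q _ ih =>
      refine (exRel hfull a (ih (hP.subst _root_.id (RelSubst.weaken Γ a V)))).congr ?_
      intro A _ _ v S
      simp only [RelSubst.env_weaken, Function.comp_id]
      exact exists_and_left
  | allRel a _ ih =>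
    refine (allRel a (ih (hQ.weaken a))).congr ?_
    intro A _ _ v S
    simp only [RelSubst.env_weaken]
    exact forall_and.trans (and_congr_right fun _ => forall_const _)
  | exRel hfull a _ ih =>
    refine (exRel hfull a (ih (hQ.weaken a))).congr ?_
    intro A _ _ v S
    simp only [RelSubst.env_weaken]
    exact exists_and_right

/-- The positions for replacing `X t̄` by `Y c t̄`, where `c` is the variable `none`. -/
def consPos (a : ℕ) (V : Type w) : Fin (a + 1) → Fin a ⊕ Option V :=
  Fin.cons (Sum.inr none) Sum.inl

theorem elim_consPos {A : Type x} {a : ℕ} (t : Fin a → A) (v : Option V → A) :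
    (fun j => Sum.elim t v (consPos a V j)) = Fin.cons (v none) t := by
  funext j
  refine Fin.cases ?_ (fun i => ?_) j <;> simp [consPos]

/-- Interchanging a quantifier over elements `c` with one over relations `R` of the other kind makes
`R` depend on `c`, so `R` is replaced by a relation with `c` as an additional first argument. -/
theorem exists_exchange {A : Type x} {a : ℕ} (p : A → ((Fin a → A) → Prop) → Prop) :
    (∃ c, ∀ R, p c R) ↔
      ∀ R : (Fin (a + 1) → A) → Prop, ∃ c, p c fun t => R (Fin.cons c t) := by
  constructor
  · rintro ⟨c, hc⟩ R
    exact ⟨c, hc _⟩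
  · contrapose!
    intro h
    choose R hR using h
    exact ⟨fun t => R (t 0) (Fin.tail t), fun c => by simpa using hR c⟩

theorem forall_exchange {A : Type x} {a : ℕ} (p : A → ((Fin a → A) → Prop) → Prop) :
    (∀ c, ∃ R, p c R) ↔
      ∃ R : (Fin (a + 1) → A) → Prop, ∀ c, p c fun t => R (Fin.cons c t) := by
  have := (exists_exchange fun c R => ¬ p c R).not
  push Not at this
  exact this

theorem exists_var {P : Query.{u, v, w, x} L Γ (Option V)} (h : IsPrenex full P) :
    IsPrenex full (L := L) (Γ := Γ) fun A _ _ v S =>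
      ∃ c : A, P A (fun o => o.elim c v) S := by
  -- The substitution takes care of the relation variables whose arity has been increased.
  suffices H : ∀ {Δ : List ℕ} (σ : RelSubst Γ Δ (Option V)),
      IsPrenex full (L := L) (Γ := Δ) fun A _ _ v S =>
        ∃ c : A, P A (fun o => o.elim c v) (RelSubst.env σ (fun o => o.elim c v) S) from
    H (RelSubst.id Γ _)
  induction h with
  | base h => exact fun σ => .base (h.subst _root_.id σ).exists_var
  | allRel a _ ih =>
    intro Δ σ
    refine (allRel (a + 1) (ih (RelSubst.cons σ (consPos a V)))).congr ?_
    intro A _ _ v S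
    rw [exists_exchange]
    simp only [RelSubst.env_cons, elim_consPos, Option.elim_none]
  | exRel hfull a _ ih =>
    intro Δ σ
    refine (exRel hfull a (ih (RelSubst.cons σ Sum.inl))).congr ?_
    intro A _ _ v S
    rw [exists_comm]
    simp [RelSubst.env_cons]

/-- A universally quantified variable in front of an existential-universal query `P` is eliminated
by writing `∀ c, P c` as `∀ X, (∀ y, ¬ X y) ∨ ∃ c, X c ∧ P c`. -/
theorem forall_var_of_isExAll {P : Query.{u, v, w, x} L Γ (Option V)} (h : IsExAll P) :
    IsPrenex full (L := L) (Γ := Γ) fun A _ _ v S =>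
      ∀ c : A, P A (fun o => o.elim c v) S := by
  have hempty : IsExAll (L := L) (Γ := 1 :: Γ) (V := V) fun A _ _ v S =>
      ∀ y : A, ¬ S 1 .zero fun _ => y := by
    refine ⟨Empty, Unit, inferInstance, inferInstance, _, .clause (.notRelVar .zero fun _ =>
      .var (Sum.inr (Sum.inr ()))), ?_⟩
    intro A _ _ v S
    simp only [exists_const, Language.Term.realize_var, Sum.elim_inr]
    exact ⟨fun h y => h (y ()), fun h y => h fun _ => y⟩
  refine (allRel 1 (.base (hempty.or ((h.subst _root_.id
    (RelSubst.weaken Γ 1 (Option V))).and_isUnitConj (.clause (.relVar .zero fun _ =>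
      .var none))).exists_var))).congr ?_
  intro A _ _ v S
  constructor
  · intro h c
    rcases h fun t => t 0 = c with h | ⟨d, hd, h⟩
    · exact absurd rfl (h c)
    · have hdc : d = c := hd
      exact hdc ▸ h
  · intro h R
    by_cases hR : ∃ c, R fun _ => c
    · obtain ⟨c, hc⟩ := hR
      exact Or.inr ⟨c, hc, h c⟩
    · exact Or.inl fun y hy => hR ⟨y, hy⟩

theorem forall_var {P : Query.{u, v, w, x} L Γ (Option V)} (h : IsPrenex full P) :
    IsPrenex full (L := L) (Γ := Γ) fun A _ _ v S =>
      ∀ c : A, P A (fun o => o.elim c v) S := by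
  suffices H : ∀ {Δ : List ℕ} (σ : RelSubst Γ Δ (Option V)),
      IsPrenex full (L := L) (Γ := Δ) fun A _ _ v S =>
        ∀ c : A, P A (fun o => o.elim c v) (RelSubst.env σ (fun o => o.elim c v) S) from
    H (RelSubst.id Γ _)
  induction h with
  | base h => exact fun σ => forall_var_of_isExAll (h.subst _root_.id σ)
  | allRel a _ ih =>
    intro Δ σ
    refine (allRel a (ih (RelSubst.cons σ Sum.inl))).congr ?_
    intro A _ _ v S
    rw [forall_comm]
    simp [RelSubst.env_cons]
  | exRel hfull a _ ih =>
    intro Δ σ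
    refine (exRel hfull (a + 1) (ih (RelSubst.cons σ (consPos a V)))).congr ?_
    intro A _ _ v S
    rw [forall_exchange]
    simp only [RelSubst.env_cons, elim_consPos, Option.elim_none]

end IsPrenex

/-! ### Formulas define prenex queries -/

/-- The query defined by a formula; its variables are the free first-order variables and the
bound ones in scope. -/
def SOFormula.query {α : Type w} {n : ℕ} (φ : SOFormula L α Γ n) :
    Query.{u, v, w, x} L Γ (α ⊕ Fin n) :=
  fun _ _ _ v S => φ.RealizeIn (v ∘ Sum.inl) (v ∘ Sum.inr) S

/-- Regard the bound variable of largest index as the variable `none`. -/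
def lastToNone (α : Type w) (n : ℕ) : α ⊕ Fin (n + 1) → Option (α ⊕ Fin n) :=
  Sum.elim (fun a => some (Sum.inl a)) (Fin.snoc (α := fun _ => Option (α ⊕ Fin n))
    (fun i => some (Sum.inr i)) none)

theorem SOFormula.query_lastToNone {α : Type w} {n : ℕ} (φ : SOFormula L α Γ (n + 1))
    {A : Type x} [L.Structure A] [Nontrivial A] (v : α ⊕ Fin n → A) (S : RelEnv A Γ) (c : A) :
    φ.query A ((fun o => o.elim c v) ∘ lastToNone α n) S ↔
      φ.RealizeIn (v ∘ Sum.inl) (Fin.snoc (v ∘ Sum.inr) c) S := by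
  have : ((fun o : Option (α ⊕ Fin n) => o.elim c v) ∘ lastToNone α n) ∘ Sum.inr =
      Fin.snoc (α := fun _ => A) (v ∘ Sum.inr) c := by
    funext i
    refine Fin.lastCases ?_ (fun j => ?_) i <;> simp [lastToNone]
  rw [SOFormula.query, this]
  rfl

/-- Negations are handled by treating a formula and its negation simultaneously. -/
theorem SOFormula.isPrenex_query_and_not {α : Type w} {full : Prop} {n : ℕ}
    (φ : SOFormula L α Γ n) (hφ : full ∨ φ.IsFirstOrder) :
    IsPrenex full φ.query.{u, v, w, x} ∧
      IsPrenex full (L := L) (Γ := Γ) fun A _ _ v S => ¬ φ.query.{u, v, w, x} A v S := by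
  induction φ with
  | falsum =>
    refine ⟨.of_isUnitClause .falsum, (IsPrenex.forall_var (.of_isUnitClause
      (.equal (.var none) (.var none) .falsum))).congr ?_⟩
    intros
    simp [query, RealizeIn]
  | equal t₁ t₂ =>
    refine ⟨(IsPrenex.of_isUnitClause (.equal t₁ t₂ .falsum)).congr ?_,
      (IsPrenex.of_isUnitClause (.notEqual t₁ t₂ .falsum)).congr ?_⟩ <;>
    · intros
      simp [query, RealizeIn]
  | rel p ts =>
    refine ⟨(IsPrenex.of_isUnitClause (.rel p ts .falsum)).congr ?_,
      (IsPrenex.of_isUnitClause (.notRel p ts .falsum)).congr ?_⟩ <;>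
    · intros
      simp [query, RealizeIn]
  | relVar X ts =>
    refine ⟨(IsPrenex.of_isUnitClause (.relVar X ts)).congr ?_,
      (IsPrenex.of_isUnitClause (.notRelVar X ts)).congr ?_⟩ <;>
    · intros
      simp [query, RealizeIn]
  | not φ ih =>
    obtain ⟨h, h'⟩ := ih hφ
    refine ⟨h', h.congr ?_⟩
    intros
    simp [query, RealizeIn]
  | and φ ψ ihφ ihψ =>
    obtain ⟨h₁, h₁'⟩ := ihφ (hφ.imp_right And.left)
    obtain ⟨h₂, h₂'⟩ := ihψ (hφ.imp_right And.right)
    refine ⟨h₁.and h₂, (h₁'.or h₂').congr ?_⟩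
    intros
    exact not_and_or.symm
  | or φ ψ ihφ ihψ =>
    obtain ⟨h₁, h₁'⟩ := ihφ (hφ.imp_right And.left)
    obtain ⟨h₂, h₂'⟩ := ihψ (hφ.imp_right And.right)
    refine ⟨h₁.or h₂, (h₁'.and h₂').congr ?_⟩
    intros
    exact not_or.symm
  | @all Γ n φ ih =>
    obtain ⟨h, h'⟩ := ih hφ
    refine ⟨(h.subst (lastToNone α n) (RelSubst.id Γ _)).forall_var.congr ?_,
      (h'.subst (lastToNone α n) (RelSubst.id Γ _)).exists_var.congr ?_⟩
    · intro A _ _ v S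
      exact forall_congr' fun c => φ.query_lastToNone v S c
    · intro A _ _ v S
      exact (exists_congr fun c => (φ.query_lastToNone v S c).not).trans not_forall.symm
  | @ex Γ n φ ih =>
    obtain ⟨h, h'⟩ := ih hφ
    refine ⟨(h.subst (lastToNone α n) (RelSubst.id Γ _)).exists_var.congr ?_,
      (h'.subst (lastToNone α n) (RelSubst.id Γ _)).forall_var.congr ?_⟩
    · intro A _ _ v S
      exact exists_congr fun c => φ.query_lastToNone v S c
    · intro A _ _ v S
      exact (forall_congr' fun c => (φ.query_lastToNone v S c).not).trans not_exists.symm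
  | allRel a φ ih =>
    have hfull : full := hφ.resolve_right fun h => h
    obtain ⟨h, h'⟩ := ih (Or.inl hfull)
    refine ⟨.allRel a h, (IsPrenex.exRel hfull a h').congr ?_⟩
    intros
    exact not_forall.symm
  | exRel a φ ih =>
    have hfull : full := hφ.resolve_right fun h => h
    obtain ⟨h, h'⟩ := ih (Or.inl hfull)
    refine ⟨.exRel hfull a h, (IsPrenex.allRel a h').congr ?_⟩
    intros
    exact not_exists.symm

theorem SOFormula.isPrenex_query {α : Type w} {full : Prop} {n : ℕ} (φ : SOFormula L α Γ n)
    (hφ : full ∨ φ.IsFirstOrder) : IsPrenex full φ.query.{u, v, w, x} :=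
  (φ.isPrenex_query_and_not hφ).1

/-! ### One-element structures -/

/-- The set of relation symbols that hold somewhere in `A`. It determines a one-element structure up
to isomorphism if only constant and relation symbols are considered. -/
def atomicType (L : FirstOrder.Language.{u, v}) (A : Type x) [L.Structure A] :
    Set (Σ a, L.Relations a) :=
  {p | ∃ t : Fin p.1 → A, Language.Structure.RelMap p.2 t}

theorem relMap_iff_mem_atomicType {A : Type x} [L.Structure A] [Subsingleton A] {a : ℕ}
    (p : L.Relations a) (t : Fin a → A) :
    Language.Structure.RelMap p t ↔ ⟨a, p⟩ ∈ atomicType L A :=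
  ⟨fun h => ⟨t, h⟩, fun ⟨t', h⟩ => Subsingleton.elim t' t ▸ h⟩

/-- In one-element structures, the truth of a second-order formula depends on the set of relation
symbols that hold only. -/
theorem SOFormula.realizeIn_iff_of_subsingleton {α : Type w} {n : ℕ} {A B : Type x} [L.Structure A]
    [L.Structure B] [Subsingleton A] [Subsingleton B] [Nonempty A] [Nonempty B]
    (hAB : atomicType L A = atomicType L B) (φ : SOFormula L α Γ n) (f : α → A) (s : Fin n → A)
    (S : RelEnv A Γ) (f' : α → B) (s' : Fin n → B) (S' : RelEnv B Γ)
    (hS : ∀ a X t t', S a X t ↔ S' a X t') : φ.RealizeIn f s S ↔ φ.RealizeIn f' s' S' := by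
  induction φ with
  | falsum => rfl
  | equal t₁ t₂ => exact iff_of_true (Subsingleton.elim _ _) (Subsingleton.elim _ _)
  | rel p ts => simp only [RealizeIn, relMap_iff_mem_atomicType, hAB]
  | relVar X ts => exact hS _ X _ _
  | not φ ih => exact (ih s S s' S' hS).not
  | and φ ψ ihφ ihψ => exact and_congr (ihφ s S s' S' hS) (ihψ s S s' S' hS)
  | or φ ψ ihφ ihψ => exact or_congr (ihφ s S s' S' hS) (ihψ s S s' S' hS)
  | all φ ih =>
    exact ⟨fun h c => (ih _ S _ S' hS).1 (h (Classical.arbitrary A)),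
      fun h c => (ih _ S _ S' hS).2 (h (Classical.arbitrary B))⟩
  | ex φ ih =>
    exact ⟨fun ⟨c, h⟩ => ⟨Classical.arbitrary B, (ih _ S _ S' hS).1 h⟩,
      fun ⟨c, h⟩ => ⟨Classical.arbitrary A, (ih _ S _ S' hS).2 h⟩⟩
  | allRel a φ ih =>
    constructor
    · intro h R
      refine (ih s _ s' _ ?_).1 (h fun _ => R fun _ => Classical.arbitrary B)
      rintro _ (_ | X) t t'
      · exact iff_of_eq (congrArg R (Subsingleton.elim _ _))
      · exact hS _ X t t'
    · intro h R
      refine (ih s _ s' _ ?_).2 (h fun _ => R fun _ => Classical.arbitrary A)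
      rintro _ (_ | X) t t'
      · exact iff_of_eq (congrArg R (Subsingleton.elim _ _))
      · exact hS _ X t t'
  | exRel a φ ih =>
    constructor
    · rintro ⟨R, h⟩
      refine ⟨fun _ => R fun _ => Classical.arbitrary A, (ih s _ s' _ ?_).1 h⟩
      rintro _ (_ | X) t t'
      · exact iff_of_eq (congrArg R (Subsingleton.elim _ _))
      · exact hS _ X t t'
    · rintro ⟨R, h⟩
      refine ⟨fun _ => R fun _ => Classical.arbitrary B, (ih s _ s' _ ?_).2 h⟩
      rintro _ (_ | X) t t'
      · exact iff_of_eq (congrArg R (Subsingleton.elim _ _))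
      · exact hS _ X t t'

/-! ### Revised Krom formulas -/

namespace SOFormula

variable {α : Type w} {n : ℕ}

theorem realizeIn_exs {A : Type x} [L.Structure A] (a : ℕ) (φ : SOFormula L α Γ (n + a))
    (f : α → A) (s : Fin n → A) (S : RelEnv A Γ) :
    (exs a φ).RealizeIn f s S ↔ ∃ z : Fin a → A, φ.RealizeIn f (Fin.append s z) S := by
  induction a with
  | zero =>
    have (z : Fin 0 → A) : Fin.append s z = s := by
      rw [Subsingleton.elim z Fin.elim0, Fin.append_elim0]
      rfl
    simp [exs, this]
  | succ a ih =>
    rw [exs, ih]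
    constructor
    · rintro ⟨z, c, h⟩
      refine ⟨Fin.snoc z c, ?_⟩
      rw [Fin.append_snoc]
      exact h
    · rintro ⟨z, h⟩
      refine ⟨Fin.init z, z (Fin.last a), ?_⟩
      rw [← Fin.append_snoc, Fin.snoc_init_self]
      exact h

theorem realizeIn_exsRelVar {A : Type x} [L.Structure A] {a : ℕ} (X : RelVar Γ a)
    (f : α → A) (s : Fin n → A) (S : RelEnv A Γ) :
    (exsRelVar (L := L) X).RealizeIn f s S ↔ ∃ z, S a X z := by
  simp [exsRelVar, realizeIn_exs, RealizeIn]

/-- `∀ x₁ ⋯ ∀ x_n φ`. -/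
def alls : (n : ℕ) → SOFormula L α Γ n → SOFormula L α Γ 0
  | 0, φ => φ
  | n + 1, φ => alls n (all φ)

theorem realizeIn_alls {A : Type x} [L.Structure A] (φ : SOFormula L α Γ n)
    (f : α → A) (s₀ : Fin 0 → A) (S : RelEnv A Γ) :
    (alls n φ).RealizeIn f s₀ S ↔ ∀ s : Fin n → A, φ.RealizeIn f s S := by
  induction n with
  | zero => exact ⟨fun h s => Subsingleton.elim s₀ s ▸ h, fun h => h s₀⟩
  | succ n ih =>
    rw [alls, ih]
    constructor
    · intro h s
      rw [← Fin.snoc_init_self s]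
      exact h _ _
    · intro h s c
      exact h _

theorem IsKromRMatrix.alls {φ : SOFormula L α Γ n} (h : φ.IsKromRMatrix) :
    (alls n φ).IsKromRMatrix := by
  induction n with
  | zero => exact h
  | succ n ih => exact ih h.all

open Classical in
/-- The clause `⋁_{p ∈ l} ± p τ … τ ∨ ∃ z̄ X z̄`, where `p` occurs negatively iff `p ∈ t`.
In a one-element structure where `X` is empty, it excludes `t` as the set of relation symbols that
hold, provided that all relation symbols are listed in `l`. -/
noncomputable def typeClause {b : ℕ} (X : RelVar Γ b) (τ : L.Term (α ⊕ Fin n))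
    (t : Set (Σ a, L.Relations a)) : List (Σ a, L.Relations a) → SOFormula L α Γ n
  | [] => or (exsRelVar X) falsum
  | p :: l => or (if p ∈ t then not (rel p.2 fun _ => τ) else rel p.2 fun _ => τ)
      (typeClause X τ t l)

theorem isKromRClause_typeClause {b : ℕ} (X : RelVar Γ b) (τ : L.Term (α ⊕ Fin n))
    (t : Set (Σ a, L.Relations a)) (l : List (Σ a, L.Relations a)) :
    (typeClause X τ t l).IsKromRClause := by
  induction l with
  | nil => exact .base (.exsRelVar X) .falsum
  | cons p l ih =>
    refine .or ?_ ih
    split_ifs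
    · exact .notRel _ _
    · exact .rel _ _

theorem realizeIn_typeClause {A : Type x} [L.Structure A] {b : ℕ} (X : RelVar Γ b)
    (τ : L.Term (α ⊕ Fin n)) (t : Set (Σ a, L.Relations a)) (l : List (Σ a, L.Relations a))
    (f : α → A) (s : Fin n → A) (S : RelEnv A Γ) :
    (typeClause X τ t l).RealizeIn f s S ↔ (∃ z, S b X z) ∨ ∃ p ∈ l,
      ¬ (p ∈ t ↔ Language.Structure.RelMap p.2 fun _ => τ.realize (Sum.elim f s)) := by
  induction l with
  | nil => simp [typeClause, RealizeIn, realizeIn_exsRelVar]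
  | cons p l ih =>
    rw [typeClause, RealizeIn, ih]
    rw [List.exists_mem_cons_iff, or_left_comm]
    by_cases h : p ∈ t <;> simp [h, RealizeIn]

end SOFormula

open SOFormula (RealizeIn realizeIn_typeClause isKromRClause_typeClause alls realizeIn_alls
  realizeIn_exsRelVar typeClause)

/-- The relation literal of a unit clause and `¬ X t̄` are the two second-order disjuncts of a Krom
clause. -/
theorem IsUnitClause.exists_isKromRClause {α : Type w} {n : ℕ} {P : Query.{u, v, w, x} L Γ V}
    (h : IsUnitClause P) (g : V → α ⊕ Fin n) {b : ℕ} (ts : Fin b → L.Term (α ⊕ Fin n)) :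
    ∃ C : SOFormula L α (b :: Γ) n, C.IsKromRClause ∧
      (∀ (A : Type x) [L.Structure A] (f : α → A) (s : Fin n → A) (R : (Fin b → A) → Prop)
        (S : RelEnv A Γ), (¬ R fun i => (ts i).realize (Sum.elim f s)) →
          C.RealizeIn f s (RelEnv.cons R S)) ∧
      ∀ (A : Type x) [L.Structure A] [Nontrivial A] (f : α → A) (s : Fin n → A)
        (R : (Fin b → A) → Prop) (S : RelEnv A Γ), C.RealizeIn f s (RelEnv.cons R S) ↔
          ((R fun i => (ts i).realize (Sum.elim f s)) → P A (Sum.elim f s ∘ g) S) := by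
  induction h with
  | falsum =>
    refine ⟨.or .falsum (.not (.relVar .zero ts)), .base .falsum (.notRelVar _ _), ?_, ?_⟩
    · intro A _ f s R S h
      exact Or.inr h
    · intro A _ _ f s R S
      simp [RealizeIn, RelEnv.cons]
  | relVar X us =>
    refine ⟨.or (.relVar X.succ fun i => (us i).relabel g) (.not (.relVar .zero ts)),
      .base (.relVar _ _) (.notRelVar _ _), ?_, ?_⟩
    · intro A _ f s R S h
      exact Or.inr h
    · intro A _ _ f s R S
      simp only [RealizeIn, RelEnv.cons, Language.Term.realize_relabel]
      tauto
  | notRelVar X us =>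
    refine ⟨.or (.not (.relVar X.succ fun i => (us i).relabel g)) (.not (.relVar .zero ts)),
      .base (.notRelVar _ _) (.notRelVar _ _), ?_, ?_⟩
    · intro A _ f s R S h
      exact Or.inr h
    · intro A _ _ f s R S
      simp only [RealizeIn, RelEnv.cons, Language.Term.realize_relabel]
      tauto
  | equal t₁ t₂ _ ih =>
    obtain ⟨C, hC, h₁, h₂⟩ := ih
    refine ⟨.or (.equal (t₁.relabel g) (t₂.relabel g)) C, .or (.equal _ _) hC,
      fun A _ f s R S h => Or.inr (h₁ A f s R S h), ?_⟩
    intro A _ _ f s R S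
    simp only [RealizeIn, h₂, Language.Term.realize_relabel]
    tauto
  | notEqual t₁ t₂ _ ih =>
    obtain ⟨C, hC, h₁, h₂⟩ := ih
    refine ⟨.or (.not (.equal (t₁.relabel g) (t₂.relabel g))) C, .or (.notEqual _ _) hC,
      fun A _ f s R S h => Or.inr (h₁ A f s R S h), ?_⟩
    intro A _ _ f s R S
    simp only [RealizeIn, h₂, Language.Term.realize_relabel]
    tauto
  | rel p us _ ih =>
    obtain ⟨C, hC, h₁, h₂⟩ := ih
    refine ⟨.or (.rel p fun i => (us i).relabel g) C, .or (.rel _ _) hC,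
      fun A _ f s R S h => Or.inr (h₁ A f s R S h), ?_⟩
    intro A _ _ f s R S
    simp only [RealizeIn, h₂, Language.Term.realize_relabel]
    tauto
  | notRel p us _ ih =>
    obtain ⟨C, hC, h₁, h₂⟩ := ih
    refine ⟨.or (.not (.rel p fun i => (us i).relabel g)) C, .or (.notRel _ _) hC,
      fun A _ f s R S h => Or.inr (h₁ A f s R S h), ?_⟩
    intro A _ _ f s R S
    simp only [RealizeIn, h₂, Language.Term.realize_relabel]
    tauto

/-- A conjunction of unit clauses stays a conjunction of Krom clauses when it is made conditional on
an atom `X t̄`, with `X` the newest relation variable. -/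
theorem IsUnitConj.exists_isKromRConj {α : Type w} {n : ℕ} {P : Query.{u, v, w, x} L Γ V}
    (h : IsUnitConj P) (g : V → α ⊕ Fin n) {b : ℕ} (ts : Fin b → L.Term (α ⊕ Fin n)) :
    ∃ C : SOFormula L α (b :: Γ) n, C.IsKromRConj ∧
      (∀ (A : Type x) [L.Structure A] (f : α → A) (s : Fin n → A) (R : (Fin b → A) → Prop)
        (S : RelEnv A Γ), (¬ R fun i => (ts i).realize (Sum.elim f s)) →
          C.RealizeIn f s (RelEnv.cons R S)) ∧
      ∀ (A : Type x) [L.Structure A] [Nontrivial A] (f : α → A) (s : Fin n → A)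
        (R : (Fin b → A) → Prop) (S : RelEnv A Γ), C.RealizeIn f s (RelEnv.cons R S) ↔
          ((R fun i => (ts i).realize (Sum.elim f s)) → P A (Sum.elim f s ∘ g) S) := by
  induction h with
  | clause h =>
    obtain ⟨C, hC, h₁, h₂⟩ := h.exists_isKromRClause g ts
    exact ⟨C, .clause hC, h₁, h₂⟩
  | and _ _ ih ih' =>
    obtain ⟨C, hC, h₁, h₂⟩ := ih
    obtain ⟨C', hC', h₁', h₂'⟩ := ih'
    refine ⟨C.and C', hC.and hC',
      fun A _ f s R S h => ⟨h₁ A f s R S h, h₁' A f s R S h⟩, ?_⟩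
    intro A _ _ f s R S
    simp only [RealizeIn, h₂, h₂']
    tauto

/-- `φ` is a revised Krom formula with second-order prefix `qs` that defines the query `P` and, in
one-element structures, expresses that the set of relation symbols that hold is not in `bad`. -/
def KromDefines {α : Type w} (qs : List Quant) (φ : SOFormula L α Γ 0)
    (P : Query.{u, v, w, x} L Γ (α ⊕ Fin 0)) (bad : Set (Set (Σ a, L.Relations a))) : Prop :=
  HasPrefix (fun _ θ => θ.IsKromRMatrix) qs φ ∧
    (∀ (A : Type x) [L.Structure A] [Nontrivial A] (v : α ⊕ Fin 0 → A) (S : RelEnv A Γ),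
      φ.query A v S ↔ P A v S) ∧
    ∀ (A : Type x) [L.Structure A] [Subsingleton A] [Nonempty A] (f : α → A) (s : Fin 0 → A)
      (S : RelEnv A Γ), φ.RealizeIn f s S ↔ atomicType L A ∉ bad

theorem KromDefines.allRel {α : Type w} {qs : List Quant} {a : ℕ} {φ : SOFormula L α (a :: Γ) 0}
    {P : Query.{u, v, w, x} L (a :: Γ) (α ⊕ Fin 0)} {bad : Set (Set (Σ a, L.Relations a))}
    (h : KromDefines qs φ P bad) : KromDefines (Quant.all :: qs) (φ.allRel a)
      (fun A _ _ v S => ∀ R : (Fin a → A) → Prop, P A v (RelEnv.cons R S)) bad := by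
  refine ⟨h.1.allRel, ?_, ?_⟩
  · intro A _ _ v S
    exact forall_congr' fun R => h.2.1 A v _
  · intro A _ _ _ f s S
    exact (forall_congr' fun R => h.2.2 A f s _).trans (forall_const _)

theorem KromDefines.exRel {α : Type w} {qs : List Quant} {a : ℕ} {φ : SOFormula L α (a :: Γ) 0}
    {P : Query.{u, v, w, x} L (a :: Γ) (α ⊕ Fin 0)} {bad : Set (Set (Σ a, L.Relations a))}
    (h : KromDefines qs φ P bad) : KromDefines (Quant.ex :: qs) (φ.exRel a)
      (fun A _ _ v S => ∃ R : (Fin a → A) → Prop, P A v (RelEnv.cons R S)) bad := by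
  refine ⟨h.1.exRel, ?_, ?_⟩
  · intro A _ _ v S
    exact exists_congr fun R => h.2.1 A v _
  · intro A _ _ _ f s S
    exact (exists_congr fun R => h.2.2 A f s _).trans (exists_const _)

/-- Clauses may be added to a conjunction `θ` of Krom clauses that make no difference if `X` is
nonempty, and that hold in a one-element structure with empty `X` if and only if its set of relation
symbols that hold is not in `bad`. -/
theorem exists_isKromRConj_typeClause {α : Type w} {n : ℕ} [Finite L.Symbols]
    (bad : Set (Set (Σ a, L.Relations a))) {b : ℕ} (X : RelVar Γ b) (τ : L.Term (α ⊕ Fin n))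
    {θ : SOFormula L α Γ n} (hθ : θ.IsKromRConj) :
    ∃ C : SOFormula L α Γ n, C.IsKromRConj ∧
      (∀ (A : Type x) [L.Structure A] (f : α → A) (s : Fin n → A) (S : RelEnv A Γ),
        C.RealizeIn f s S → θ.RealizeIn f s S) ∧
      (∀ (A : Type x) [L.Structure A] (f : α → A) (s : Fin n → A) (S : RelEnv A Γ),
        (∃ z, S b X z) → θ.RealizeIn f s S → C.RealizeIn f s S) ∧
      ∀ (A : Type x) [L.Structure A] [Subsingleton A] (f : α → A) (s : Fin n → A)
        (S : RelEnv A Γ), (¬ ∃ z, S b X z) →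
          (C.RealizeIn f s S ↔ θ.RealizeIn f s S ∧ atomicType L A ∉ bad) := by
  have : Finite (Σ a, L.Relations a) :=
    Finite.of_injective (Sum.inr : _ → L.Symbols) Sum.inr_injective
  have := Fintype.ofFinite (Σ a, L.Relations a)
  have htype (A : Type x) [L.Structure A] [Subsingleton A] (f : α → A) (s : Fin n → A)
      (S : RelEnv A Γ) (hS : ¬ ∃ z, S b X z) (t : Set (Σ a, L.Relations a)) :
      (typeClause X τ t Finset.univ.toList).RealizeIn f s S ↔ atomicType L A ≠ t := by
    rw [realizeIn_typeClause, or_iff_right hS, ne_comm, Ne, Set.ext_iff, not_forall]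
    simp only [Finset.mem_toList, Finset.mem_univ, true_and, relMap_iff_mem_atomicType]
  induction bad, Set.toFinite bad using Set.Finite.induction_on with
  | empty => exact ⟨θ, hθ, by simp⟩
  | @insert t bad _ _ ih =>
    obtain ⟨C, hC, h₁, h₂, h₃⟩ := ih
    refine ⟨.and (typeClause X τ t Finset.univ.toList) C,
      .and (.clause (isKromRClause_typeClause _ _ _ _)) hC, ?_, ?_, ?_⟩
    · intro A _ f s S h
      exact h₁ A f s S h.2
    · intro A _ f s S hS h
      exact ⟨(realizeIn_typeClause _ _ _ _ f s S).2 (Or.inl hS), h₂ A f s S hS h⟩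
    · intro A _ _ f s S hS
      rw [RealizeIn, htype A f s S hS, h₃ A f s S hS, Set.mem_insert_iff]
      tauto

/-- The query `∃ x̄ ∀ ȳ ψ` is expressed by introducing a relation `S` of witnesses: `S` is nonempty,
and `S c d x̄` implies `c ≠ d` and `ψ`, for all `ȳ`. The arguments `c` and `d` ensure that `S` is
empty in one-element structures and nonempty in all others. -/
theorem IsExAll.exists_kromDefines {α : Type w} [Finite L.Symbols]
    {P : Query.{u, v, w, x} L Γ (α ⊕ Fin 0)} (h : IsExAll P)
    (bad : Set (Set (Σ a, L.Relations a))) :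
    ∃ φ : SOFormula L α Γ 0, KromDefines [Quant.ex] φ P bad := by
  obtain ⟨X, Y, hX, hY, Q, hQ, e⟩ := h
  -- The indices `Sum.inl false` and `Sum.inl true` stand for the variables `c` and `d`.
  obtain ⟨N, ⟨i⟩⟩ := Finite.exists_equiv_fin (Bool ⊕ X ⊕ Y)
  obtain ⟨b, ⟨j⟩⟩ := Finite.exists_equiv_fin (Bool ⊕ X)
  let vr (k : Bool ⊕ X ⊕ Y) : L.Term (α ⊕ Fin N) := .var (Sum.inr (i k))
  let ts (k : Fin b) : L.Term (α ⊕ Fin N) := vr (Sum.map _root_.id Sum.inl (j.symm k))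
  obtain ⟨C, hC, hC₁, hC₂⟩ := hQ.exists_isKromRConj
    (Sum.elim (Sum.elim Sum.inl Fin.elim0) fun k => Sum.inr (i (Sum.inr k))) ts
  let S₀ : RelVar (b :: Γ) b := .zero
  let θ : SOFormula L α (b :: Γ) N := .and C (.and
    (.or (.not (.equal (vr (Sum.inl false)) (vr (Sum.inl true))))
      (.or (.not (.relVar S₀ ts)) .falsum))
    (.or (.equal (vr (Sum.inl false)) (vr (Sum.inl true))) (.or (.exsRelVar S₀) .falsum)))
  have hθ : θ.IsKromRConj := hC.and (.and
    (.clause (.or (.notEqual _ _) (.base (.notRelVar _ _) .falsum)))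
    (.clause (.or (.equal _ _) (.base (.exsRelVar _) .falsum))))
  have realize_ts {A : Type x} [L.Structure A] (f : α → A) (s : Fin N → A) :
      (fun k => (ts k).realize (Sum.elim f s)) =
        fun k => s (i (Sum.map _root_.id Sum.inl (j.symm k))) := rfl
  have realize_θ {A : Type x} [L.Structure A] (f : α → A) (s : Fin N → A)
      (R : (Fin b → A) → Prop) (S : RelEnv A Γ) : θ.RealizeIn f s (RelEnv.cons R S) ↔
        C.RealizeIn f s (RelEnv.cons R S) ∧
        (¬ s (i (Sum.inl false)) = s (i (Sum.inl true)) ∨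
          ¬ R fun k => s (i (Sum.map _root_.id Sum.inl (j.symm k)))) ∧
        (s (i (Sum.inl false)) = s (i (Sum.inl true)) ∨ ∃ z, R z) := by
    simp only [θ, vr, RealizeIn, realizeIn_exsRelVar, realize_ts, or_false,
      Language.Term.realize_var, Sum.elim_inr]
    rfl
  obtain ⟨D, hD, hD₁, hD₂, hD₃⟩ :=
    exists_isKromRConj_typeClause.{u, v, w, x} bad S₀ (vr (Sum.inl false)) hθ
  refine ⟨.exRel b (alls N D), .exRel (.matrix (SOFormula.IsKromRMatrix.conj hD).alls), ?_, ?_⟩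
  · intro A _ _ v S
    rw [e]
    simp only [SOFormula.query, RealizeIn, realizeIn_alls]
    constructor
    · rintro ⟨R, hR⟩
      have hR' s := (realize_θ _ s R S).1 (hD₁ _ _ _ _ (hR s))
      obtain ⟨c, d, hcd⟩ := exists_pair_ne A
      obtain ⟨z, hz⟩ : ∃ z, R z := by
        refine ((hR' fun k => Sum.elim (fun o => if o then d else c) (fun _ => c)
          (i.symm k)).2.2).resolve_left ?_
        simpa using hcd
      refine ⟨fun k => z (j (Sum.inr k)), fun y => ?_⟩
      let s : Fin N → A := fun k =>
        Sum.elim (fun k => z (j (Sum.inl k))) (Sum.elim (fun k => z (j (Sum.inr k))) y) (i.symm k)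
      have hs : (fun k => s (i (Sum.map _root_.id Sum.inl (j.symm k)))) = z := by
        funext k
        obtain ⟨k, rfl⟩ := j.surjective k
        rcases k with k | k <;> simp [s]
      have := (hC₂ A _ s R S).1 (hR' s).1 (by rwa [realize_ts, hs])
      convert this using 1
      funext k
      rcases k with (k | k) | k | k
      · rfl
      · exact k.elim0
      · simp [s]
      · simp [s]
    · rintro ⟨z, hz⟩
      let R (t : Fin b → A) : Prop :=
        t (j (Sum.inl false)) ≠ t (j (Sum.inl true)) ∧ ∀ k, t (j (Sum.inr k)) = z k
      have hR : ∃ t, R t := by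
        obtain ⟨c, d, hcd⟩ := exists_pair_ne A
        refine ⟨fun k => Sum.elim (fun o => if o then c else d) z (j.symm k), ?_, ?_⟩
        · simpa using hcd.symm
        · simp
      refine ⟨R, fun s => hD₂ _ _ _ _ hR ((realize_θ _ s R S).2 ⟨?_, ?_, Or.inr hR⟩)⟩
      · rw [hC₂, realize_ts]
        intro hs
        convert hz fun k => s (i (Sum.inr (Sum.inr k))) using 1
        funext k
        rcases k with (k | k) | k | k
        · rfl
        · exact k.elim0
        · simpa using hs.2 k
        · rfl
      · by_contra! hs
        simpa [hs.1] using hs.2.1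
  · intro A _ _ _ f s S
    simp only [RealizeIn, realizeIn_alls]
    constructor
    · rintro ⟨R, hR⟩
      have hR' s := (realize_θ _ s R S).1 (hD₁ _ _ _ _ (hR s))
      have hempty : ¬ ∃ z, R z := by
        rintro ⟨z, hz⟩
        refine ((hR' fun _ => Classical.arbitrary A).2.1).elim (fun h => h rfl) fun h => h ?_
        convert hz using 1
      exact ((hD₃ A f _ (RelEnv.cons R S) hempty).1 (hR fun _ => Classical.arbitrary A)).2
    · intro h
      have hempty : ¬ ∃ z : Fin b → A, (fun _ => False) z := by simp
      refine ⟨fun _ => False, fun s => (hD₃ A f s _ hempty).2 ⟨(realize_θ _ s _ S).2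
        ⟨hC₁ A f s _ S fun h => h, Or.inr fun h => h, Or.inl (Subsingleton.elim _ _)⟩, h⟩⟩

theorem IsPrenex.exists_kromDefines {α : Type w} [Finite L.Symbols] {full : Prop}
    {P : Query.{u, v, w, x} L Γ (α ⊕ Fin 0)} (h : IsPrenex full P)
    (bad : Set (Set (Σ a, L.Relations a))) :
    ∃ qs : List Quant, (full ∨ ∀ q ∈ qs, q = Quant.all) ∧
      ∃ φ : SOFormula L α Γ 0, KromDefines (qs ++ [Quant.ex]) φ P bad := by
  induction h with
  | base h => exact ⟨[], by simp, h.exists_kromDefines bad⟩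
  | allRel a _ ih =>
    obtain ⟨qs, hqs, φ, hφ⟩ := ih
    exact ⟨Quant.all :: qs, by simpa using hqs, φ.allRel a, hφ.allRel⟩
  | exRel hfull a _ ih =>
    obtain ⟨qs, _, φ, hφ⟩ := ih
    exact ⟨Quant.ex :: qs, Or.inl hfull, φ.exRel a, hφ.exRel⟩

theorem HasPrefix.exists_kromDefines {α : Type w} [Finite L.Symbols] {qs : List Quant}
    {φ : SOFormula L α Γ 0} (h : HasPrefix (fun _ θ => θ.IsFirstOrder) qs φ)
    (bad : Set (Set (Σ a, L.Relations a))) :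
    ∃ rs : List Quant, (∀ q ∈ rs, q = Quant.all) ∧
      ∃ ψ : SOFormula L α Γ 0,
        KromDefines (qs ++ (rs ++ [Quant.ex])) ψ φ.query.{u, v, w, x} bad := by
  induction h with
  | @matrix Γ θ h =>
    obtain ⟨rs, hrs, ψ, hψ⟩ := (θ.isPrenex_query (full := False) (Or.inr h)).exists_kromDefines bad
    exact ⟨rs, hrs.resolve_left fun h => h, ψ, hψ⟩
  | @exRel Γ a qs φ _ ih =>
    obtain ⟨rs, hrs, ψ, hψ⟩ := ih
    exact ⟨rs, hrs, ψ.exRel a, hψ.exRel⟩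
  | @allRel Γ a qs φ _ ih =>
    obtain ⟨rs, hrs, ψ, hψ⟩ := ih
    exact ⟨rs, hrs, ψ.allRel a, hψ.allRel⟩

/-- The sets of relation symbols that hold in the one-element structures where `φ` is false for
some assignment. -/
def falseTypes {α : Type w} (φ : SOFormula L α [] 0) : Set (Set (Σ a, L.Relations a)) :=
  {t | ∃ (A : Type x) (_ : L.Structure A) (_ : Subsingleton A) (_ : Nonempty A) (f : α → A),
    atomicType L A = t ∧ ¬ φ.Realize f}

theorem KromDefines.finEquiv {α : Type w} {qs : List Quant} {φ ψ : SOFormula L α [] 0}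
    (h : KromDefines qs ψ φ.query.{u, v, w, x} (falseTypes.{u, v, w, x} φ)) :
    FinEquiv.{u, v, w, x} φ ψ := by
  intro A _ _ _ f
  rcases subsingleton_or_nontrivial A with hA | hA
  · rw [SOFormula.Realize, SOFormula.Realize, h.2.2 A f]
    constructor
    · rintro hφ ⟨B, _, _, _, g, hB, hg⟩
      exact hg ((φ.realizeIn_iff_of_subsingleton hB.symm _ _ _ _ _ _
        fun _ X => nomatch X).1 hφ)
    · intro hA'
      by_contra hφ
      exact hA' ⟨A, _, hA, inferInstance, f, rfl, hφ⟩
  · exact (h.2.1 A (Sum.elim f Fin.elim0) (RelEnv.nil A)).symm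

end Classes

/-! ### Alternations -/

/-- If the number of alternations has the parity that makes a prefix end with a universal
quantifier, then adding universal quantifiers and one existential quantifier adds one
alternation. -/
theorem alternations_append (q : Quant) (qs rs : List Quant) (hrs : ∀ r ∈ rs, r = Quant.all)
    (h : Even (alternations (q :: qs)) ↔ q = Quant.all) :
    alternations (q :: (qs ++ (rs ++ [Quant.ex]))) = alternations (q :: qs) + 1 := by
  induction qs generalizing q with
  | nil =>
    obtain rfl : q = Quant.all := h.1 (by simp [alternations])
    simp only [List.nil_append]
    induction rs with
    | nil => rfl
    | cons r rs ih =>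
      obtain rfl := hrs r (by simp)
      have := ih fun r hr => hrs r (by simp [hr])
      simpa [alternations] using this
  | cons q' qs ih =>
    have := ih q' (by
      rw [alternations] at h
      cases q <;> cases q' <;> simp at h ⊢ <;> grind)
    rw [List.cons_append, alternations, this, alternations, add_assoc]

theorem PrefixClass.exists_kromR {L : FirstOrder.Language.{u, v}} [Finite L.Symbols] {α : Type w}
    {q : Quant} {k : ℕ} (hk : Odd k ↔ q = Quant.all) :
    LogicLE.{u, v, w, x} (PrefixClass (L := L) (α := α) (fun _ θ => θ.IsFirstOrder) q k)
      (PrefixClass (fun _ θ => θ.IsKromRMatrix) q (k + 1)) := by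
  rintro φ ⟨qs, hφ, rfl⟩
  obtain ⟨rs, hrs, ψ, hψ⟩ := hφ.exists_kromDefines (falseTypes.{u, v, w, x} φ)
  refine ⟨ψ, ⟨qs ++ (rs ++ [Quant.ex]), hψ.1, ?_⟩, hψ.finEquiv⟩
  rw [alternations_append q qs rs hrs (by rw [← hk, Nat.odd_add_one, Nat.not_odd_iff_even])]

end SecondOrder

/-- The vocabulary `L` consists of finitely many constant symbols and relation symbols. -/
theorem mainTheorem3 (L : FirstOrder.Language.{u, v}) [Finite L.Symbols]
    (hL : ∀ n : ℕ, IsEmpty (L.Functions (n + 1))) (α : Type w) :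
    SecondOrder.LogicLE.{u, v, w, x} (Set.univ : Set (SecondOrder.SOFormula L α [] 0))
        (SecondOrder.SOKromR L α) ∧
      ∀ k : ℕ, 1 ≤ k →
        (Even k → SecondOrder.LogicLE.{u, v, w, x} (SecondOrder.Sigma1 L α k)
          (SecondOrder.Sigma1KromR L α (k + 1))) ∧
        (Odd k → SecondOrder.LogicLE.{u, v, w, x} (SecondOrder.Pi1 L α k)
          (SecondOrder.Pi1KromR L α (k + 1))) := by
  refine ⟨?_, fun k _ => ⟨fun hk => ?_, fun hk => ?_⟩⟩
  · intro φ _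
    obtain ⟨qs, _, ψ, hψ⟩ := (φ.isPrenex_query (full := True) (Or.inl trivial)).exists_kromDefines
      (SecondOrder.falseTypes.{u, v, w, x} φ)
    exact ⟨ψ, ⟨_, hψ.1⟩, hψ.finEquiv⟩
  · exact SecondOrder.PrefixClass.exists_kromR (by simpa using hk)
  · exact SecondOrder.PrefixClass.exists_kromR (by simpa using hk)
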